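/- Let $1\le k\le n$ and $m\ge k$ be integers, let $\sigma\ge 0$, and let $A$ be a real $m\times n$ matrix. Suppose that we observe $y=Ax+z$, where $z\sim N(0,\sigma^2 I_m)$ and $x\in\Sigma_k:=\{x\in\mathbb{R}^n : x \text{ has at most } k \text{ nonzero entries}\}$. Define the minimax risk $$M^*(A)=\inf_{\hat x}\ \sup_{x\in\Sigma_k}\ \mathbb{E}\Big[\tfrac1n\|\hat x(Ax+z)-x\|_2^2\Big]\in[0,\infty],$$ the infimum being over all measurable maps $\hat x:\mathbb{R}^m\to\mathbb{R}^n$. Write $\|A\|_F$ for the Frobenius norm of $A$. Then there is an absolute constant $C_1>0$ (independent of $m,n,k,\sigma,A$) such that for all such $m,n,k,\sigma$ and $A$ $$M^*(A)\ \ge\ C_1\,\frac{k\sigma^2}{\|A\|_F^2}\,\log(n/k).$$ Moreover, for all such $m,n,k,\sigma$ and $A$, $$M^*(A)\ \ge\ \frac{k\sigma^2}{\|A\|_F^2}.$$ When $A=0$, a right-hand side is read as $+\infty$ if its numerator is positive and as $0$ if its numerator is $0$. -/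

import Mathlib

open MeasureTheory ProbabilityTheory
open scoped ENNReal

noncomputable section

/-- The set `Σ_k ⊆ ℝⁿ` of vectors with at most `k` nonzero entries. -/
def sparseVectors (n k : ℕ) : Set (EuclideanSpace ℝ (Fin n)) :=
  {x | {i : Fin n | x i ≠ 0}.ncard ≤ k}

open scoped Matrix.Norms.Frobenius in
/-- The Frobenius norm `‖A‖_F` of a real matrix. -/
def frobeniusNorm {m n : ℕ} (A : Matrix (Fin m) (Fin n) ℝ) : ℝ := ‖A‖

/-- The law `N(0, σ² I)` of the noise vector in `ℝᵐ`. -/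
def noiseLaw (m : ℕ) (σ : ℝ) : Measure (EuclideanSpace ℝ (Fin m)) :=
  multivariateGaussian 0 (σ ^ 2 • (1 : Matrix (Fin m) (Fin m) ℝ))

/-- The law of the observation `y = A x + z`, where `z ∼ N(0, σ² I)`. -/
def observationLaw {m n : ℕ} (A : Matrix (Fin m) (Fin n) ℝ) (σ : ℝ)
    (x : EuclideanSpace ℝ (Fin n)) : Measure (EuclideanSpace ℝ (Fin m)) :=
  (noiseLaw m σ).map (fun z => A.toEuclideanLin x + z)

/-- The mean-squared error `E[(1/n) ‖x̂(y) - x‖²]` of the estimator `x̂` at `x`, with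
`y = A x + z`. It is the expectation of a nonnegative quantity and may be `∞`. -/
def meanSquaredError {m n : ℕ} (A : Matrix (Fin m) (Fin n) ℝ) (σ : ℝ)
    (xhat : EuclideanSpace ℝ (Fin m) → EuclideanSpace ℝ (Fin n))
    (x : EuclideanSpace ℝ (Fin n)) : ℝ≥0∞ :=
  ∫⁻ y, ENNReal.ofReal ((1 / (n : ℝ)) * ‖xhat y - x‖ ^ 2) ∂(observationLaw A σ x)

/-- The minimax risk `M*(A)`: the infimum over all (measurable) estimators of the worst-case
mean-squared error over the `k`-sparse vectors. -/
def sparseMinimaxRisk {m n : ℕ} (k : ℕ) (σ : ℝ) (A : Matrix (Fin m) (Fin n) ℝ) : ℝ≥0∞ :=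
  ⨅ (xhat : EuclideanSpace ℝ (Fin m) → EuclideanSpace ℝ (Fin n)) (_ : Measurable xhat),
    ⨆ x ∈ sparseVectors n k, meanSquaredError A σ xhat x

end

/-!
Both bounds are Bayes lower bounds: the worst-case risk over the `k`-sparse vectors is at least the
average risk under any prior supported on them. Writing `a_j` for the columns of `A`, one has
`∑ j, ‖a_j‖² = ‖A‖_F²`, so sets of typical columns have small norms.

For the bound with constant `1`, let `T` be a set of `k` columns with `∑ j ∈ T, ‖a_j‖²` at most
`(k / n) ‖A‖_F²`, and let `x = τ g` with `g` standard Gaussian on the coordinates in `T`. For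
`j ∈ T` the score `⟪a_j, w⟫ / σ - g_j / τ` is uncorrelated with the observation
`τ A g + σ w`, hence, all being jointly Gaussian, independent of it. Cauchy-Schwarz against the
score bounds the error in `x_j` below by `1 / (1 / τ² + ‖a_j‖² / σ²)`
(`le_lintegral_sq_sub_of_apply_eq_zero`). Summing over `T`, using the inequality between harmonic
and arithmetic means, and letting `τ → ∞` gives the claim. It also shows that the risk is infinite
if `A = 0 < σ`.

The logarithmic bound follows from the first one if `n / k` is bounded. Otherwise at least half of
the columns satisfy `‖a_j‖² ≤ 2 ‖A‖_F² / n`; among them choose `k` disjoint blocks of size `b`, of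
the order of `n / k`, and let `x` have a single entry `μ` at an independent uniform place of every
block. Even if the other blocks are known, finding the spike of a block means deciding between `b`
Gaussian laws, translates of each other by vectors of squared norm at most `σ² log b / 2` if
`μ² = n σ² log b / (4 ‖A‖_F²)`. Comparing each of them with the untranslated law
(`stdGaussian_real_translate_le`) shows that disjoint decision regions are hit with average
probability at most `b ^ (-1 / 4) ≤ 1 / 2` (`sum_stdGaussian_real_translate_le`), so that each block
contributes at least `μ² / 4` to the average of `‖x̂ - x‖²`.
-/

open scoped RealInnerProductSpace

/-! ### Standard Gaussian laws -/

/-- The density of the standard Gaussian law of a Euclidean space with respect to the volume. -/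
noncomputable def stdGaussianDensity {V : Type*} [NormedAddCommGroup V] [InnerProductSpace ℝ V]
    (x : V) : ℝ :=
  (2 * Real.pi) ^ (-(Module.finrank ℝ V / 2 : ℝ)) * Real.exp (-(1 / 2) * ‖x‖ ^ 2)

section Gaussian

variable {V : Type*} [NormedAddCommGroup V] [InnerProductSpace ℝ V]

lemma stdGaussianDensity_pos (x : V) : 0 < stdGaussianDensity x := by
  unfold stdGaussianDensity
  positivity

lemma continuous_stdGaussianDensity : Continuous (stdGaussianDensity : V → ℝ) := by
  unfold stdGaussianDensity
  fun_prop

/-- The translated density is, up to the factor `exp (‖u‖² / 2)`, a geometric mean of two Gaussian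
densities; this is the AM-GM inequality for that mean. -/
lemma stdGaussianDensity_sub_le (u x : V) {t : ℝ} (ht : 0 < t) :
    stdGaussianDensity (x - u) ≤ Real.exp (‖u‖ ^ 2 / 2) / 2 *
      (t * stdGaussianDensity x + t⁻¹ * stdGaussianDensity (x - (2 : ℝ) • u)) := by
  have hsq : stdGaussianDensity (x - u) ^ 2 = Real.exp (‖u‖ ^ 2 / 2) ^ 2 *
      (stdGaussianDensity x * stdGaussianDensity (x - (2 : ℝ) • u)) := by
    unfold stdGaussianDensity
    have : Real.exp (-(1 / 2) * ‖x - u‖ ^ 2) ^ 2 = Real.exp (‖u‖ ^ 2 / 2) ^ 2 *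
        (Real.exp (-(1 / 2) * ‖x‖ ^ 2) * Real.exp (-(1 / 2) * ‖x - (2 : ℝ) • u‖ ^ 2)) := by
      simp only [← Real.exp_nat_mul, ← Real.exp_add]
      congr 1
      rw [norm_sub_sq_real, norm_sub_sq_real, norm_smul, real_inner_smul_right]
      norm_num
      ring
    rw [mul_pow, this]
    ring
  have h0 := stdGaussianDensity_pos x
  have h2 := stdGaussianDensity_pos (x - (2 : ℝ) • u)
  refine abs_le_of_sq_le_sq' ?_ (by positivity) |>.2
  rw [hsq]
  set a := stdGaussianDensity x
  set b := stdGaussianDensity (x - (2 : ℝ) • u)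
  have : a * b ≤ ((t * a + t⁻¹ * b) / 2) ^ 2 := by
    have h : (t * a) * (t⁻¹ * b) = a * b := by field_simp
    nlinarith [sq_nonneg (t * a - t⁻¹ * b)]
  calc _ ≤ Real.exp (‖u‖ ^ 2 / 2) ^ 2 * ((t * a + t⁻¹ * b) / 2) ^ 2 := by gcongr
    _ = _ := by ring

variable [FiniteDimensional ℝ V] [MeasurableSpace V] [BorelSpace V]

lemma integrable_stdGaussianDensity : Integrable (stdGaussianDensity : V → ℝ) := by
  have h := (GaussianFourier.integrable_cexp_neg_mul_sq_norm_add
    (b := (1 / 2 : ℂ)) (by norm_num) 0 (0 : V)).re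
  refine Integrable.const_mul (h.congr (.of_forall fun x => ?_)) _
  have : (-(1 / 2 : ℂ) * (‖x‖ : ℂ) ^ 2 + 0 * ((⟪(0 : V), x⟫ : ℝ) : ℂ)) =
      ((-(1 / 2) * ‖x‖ ^ 2 : ℝ) : ℂ) := by push_cast; ring
  dsimp only
  rw [this, ← Complex.ofReal_exp]
  exact RCLike.ofReal_re (K := ℂ) _

lemma stdGaussian_eq_withDensity :
    stdGaussian V = volume.withDensity fun x => ENNReal.ofReal (stdGaussianDensity x) := by
  have : IsFiniteMeasure
      (volume.withDensity fun x : V => ENNReal.ofReal (stdGaussianDensity x)) := by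
    refine isFiniteMeasure_withDensity_ofReal integrable_stdGaussianDensity.2
  refine Measure.ext_of_charFun (funext fun t => ?_)
  rw [charFun_stdGaussian, charFun_apply, integral_withDensity_eq_integral_toReal_smul
    (continuous_stdGaussianDensity.measurable.ennreal_ofReal) (by simp)]
  have h := GaussianFourier.integral_cexp_neg_mul_sq_norm_add
    (b := (1 / 2 : ℂ)) (by norm_num) Complex.I t
  have hint : ∀ x : V, (ENNReal.ofReal (stdGaussianDensity x)).toReal •
      Complex.exp (⟪x, t⟫ * Complex.I) =
      (((2 * Real.pi) ^ (-(Module.finrank ℝ V / 2 : ℝ)) : ℝ) : ℂ) *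
        Complex.exp (-(1 / 2 : ℂ) * (‖x‖ : ℂ) ^ 2 + Complex.I * ⟪t, x⟫) := by
    intro x
    rw [ENNReal.toReal_ofReal (stdGaussianDensity_pos x).le, Complex.exp_add, stdGaussianDensity,
      real_inner_comm, mul_comm Complex.I, Complex.real_smul]
    push_cast
    ring
  simp_rw [hint]
  rw [integral_const_mul, h]
  have hc : (((2 * Real.pi) ^ (-(Module.finrank ℝ V / 2 : ℝ)) : ℝ) : ℂ) *
      ((Real.pi : ℂ) / (1 / 2 : ℂ)) ^ ((Module.finrank ℝ V : ℂ) / 2) = 1 := by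
    have : (Real.pi : ℂ) / (1 / 2 : ℂ) = ((2 * Real.pi : ℝ) : ℂ) := by push_cast; ring
    rw [this,
      show (Module.finrank ℝ V : ℂ) / 2 = ((Module.finrank ℝ V / 2 : ℝ) : ℂ) by push_cast; rfl,
      ← Complex.ofReal_cpow (by positivity), ← Complex.ofReal_mul,
      ← Real.rpow_add (by positivity)]
    simp
  rw [← mul_assoc, hc, one_mul, Complex.I_sq]
  congr 1
  ring

/-- A quantitative form of the mutual absolute continuity of a Gaussian law and its translate by
`u`. The second summand is the total mass of the translate by `2 • u`. -/
lemma stdGaussian_real_translate_le (u : V) {D : Set V} (hD : MeasurableSet D) {t : ℝ}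
    (ht : 0 < t) :
    (stdGaussian V).real ((fun z => z + u) ⁻¹' D) ≤
      Real.exp (‖u‖ ^ 2 / 2) / 2 * (t * (stdGaussian V).real D + t⁻¹) := by
  have hi := integrable_stdGaussianDensity (V := V)
  have hreal : ∀ S : Set V, MeasurableSet S →
      (stdGaussian V).real S = ∫ x in S, stdGaussianDensity x := by
    intro S hS
    rw [Measure.real, stdGaussian_eq_withDensity, withDensity_apply _ hS,
      ← ofReal_integral_eq_lintegral_ofReal hi.integrableOn
        (.of_forall fun x => (stdGaussianDensity_pos x).le),
      ENNReal.toReal_ofReal (integral_nonneg fun x => (stdGaussianDensity_pos x).le)]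
  have hone : ∫ x : V, stdGaussianDensity x = 1 := by
    rw [← setIntegral_univ, ← hreal _ .univ]
    simp
  rw [hreal _ hD, hreal _ (measurable_add_const u hD)]
  have hshift : ∫ x in (fun z => z + u) ⁻¹' D, stdGaussianDensity x =
      ∫ x in D, stdGaussianDensity (x - u) := by
    have := (measurePreserving_add_right volume u).setIntegral_preimage_emb
      (MeasurableEquiv.addRight u).measurableEmbedding
      (fun x => stdGaussianDensity (x - u)) D
    simpa only [add_sub_cancel_right] using this
  have hsub : ∀ w : V, Integrable fun x => stdGaussianDensity (x - w) := fun w =>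
    hi.comp_sub_right w
  have htail : ∫ x in D, stdGaussianDensity (x - (2 : ℝ) • u) ≤ 1 := by
    calc _ ≤ ∫ x, stdGaussianDensity (x - (2 : ℝ) • u) :=
          setIntegral_le_integral (hsub _) (.of_forall fun x => (stdGaussianDensity_pos _).le)
      _ = 1 := by rw [integral_sub_right_eq_self (fun x : V => stdGaussianDensity x), hone]
  rw [hshift]
  calc _ ≤ ∫ x in D, Real.exp (‖u‖ ^ 2 / 2) / 2 *
        (t * stdGaussianDensity x + t⁻¹ * stdGaussianDensity (x - (2 : ℝ) • u)) := by
        refine setIntegral_mono (hsub u).integrableOn ?_ fun x => stdGaussianDensity_sub_le u x ht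
        exact (((hi.const_mul t).add ((hsub _).const_mul t⁻¹)).const_mul _).integrableOn
    _ = Real.exp (‖u‖ ^ 2 / 2) / 2 * (t * (∫ x in D, stdGaussianDensity x) +
        t⁻¹ * ∫ x in D, stdGaussianDensity (x - (2 : ℝ) • u)) := by
        rw [integral_const_mul, integral_add (hi.const_mul t).integrableOn
          ((hsub _).const_mul t⁻¹).integrableOn, integral_const_mul, integral_const_mul]
    _ ≤ _ := by
        gcongr
        exact mul_le_of_le_one_right (by positivity) htail

lemma covariance_inner_stdGaussian (x y : V) :
    cov[fun ω => ⟪x, ω⟫, fun ω => ⟪y, ω⟫; stdGaussian V] = ⟪x, y⟫ := by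
  rw [← covarianceBilin_apply_eq_cov IsGaussian.memLp_two_id, covarianceBilin_stdGaussian]
  rfl

lemma memLp_two_inner_stdGaussian (x : V) : MemLp (fun ω => ⟪x, ω⟫) 2 (stdGaussian V) :=
  IsGaussian.memLp_two_id.const_inner x

lemma integral_inner_stdGaussian (x : V) : ∫ ω, ⟪x, ω⟫ ∂stdGaussian V = 0 :=
  integral_strongDual_stdGaussian (innerSL ℝ x)

lemma integral_inner_mul_inner_stdGaussian (x y : V) :
    ∫ ω, ⟪x, ω⟫ * ⟪y, ω⟫ ∂stdGaussian V = ⟪x, y⟫ := by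
  have h := covariance_eq_sub (memLp_two_inner_stdGaussian x) (memLp_two_inner_stdGaussian y)
  rw [covariance_inner_stdGaussian, integral_inner_stdGaussian] at h
  simpa using h.symm

/-- A Gaussian form of the van Trees inequality. Estimate `⟪x₀, ω⟫` from the linear observation
`Y ω`. If `Y v = 0`, then `⟪v, ω⟫` is uncorrelated with `Y ω`, hence independent of it, and the
inequality is Cauchy-Schwarz for the estimation error against `⟪v, ω⟫`. -/
lemma le_lintegral_sq_sub_of_apply_eq_zero {F : Type*} [NormedAddCommGroup F]
    [InnerProductSpace ℝ F] [FiniteDimensional ℝ F] [MeasurableSpace F] [BorelSpace F]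
    (Y : V →L[ℝ] F) (x₀ v : V) (hv : v ≠ 0) (hY : Y v = 0) {f : F → ℝ} (hf : Measurable f) :
    ENNReal.ofReal (⟪x₀, v⟫ ^ 2 / ‖v‖ ^ 2) ≤
      ∫⁻ ω, ENNReal.ofReal ((f (Y ω) - ⟪x₀, ω⟫) ^ 2) ∂stdGaussian V := by
  set γ := stdGaussian V
  by_cases htop : ∫⁻ ω, ENNReal.ofReal ((f (Y ω) - ⟪x₀, ω⟫) ^ 2) ∂γ = ∞
  · simp [htop]
  have hfY : Measurable fun ω => f (Y ω) := hf.comp Y.continuous.measurable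
  have herr_meas : Measurable fun ω => f (Y ω) - ⟪x₀, ω⟫ := hfY.sub (by fun_prop)
  have herr_sq : Integrable (fun ω => (f (Y ω) - ⟪x₀, ω⟫) ^ 2) γ :=
    ⟨(herr_meas.pow_const 2).aestronglyMeasurable, by
      rw [hasFiniteIntegral_iff_ofReal (.of_forall fun ω => sq_nonneg _)]
      exact lt_top_iff_ne_top.2 htop⟩
  have herr : MemLp (fun ω => f (Y ω) - ⟪x₀, ω⟫) 2 γ :=
    (memLp_two_iff_integrable_sq herr_meas.aestronglyMeasurable).2 herr_sq
  have hx := memLp_two_inner_stdGaussian x₀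
  have hs := memLp_two_inner_stdGaussian v
  have hfL : MemLp (fun ω => f (Y ω)) 2 γ :=
    (herr.add hx).ae_eq (.of_forall fun ω => sub_add_cancel _ _)
  have hind : IndepFun Y (fun ω => ⟪v, ω⟫) γ := by
    refine HasGaussianLaw.indepFun_of_covariance_inner
      (IsGaussian.hasGaussianLaw_id.map_fun (Y.prod (innerSL ℝ v))) fun a c => ?_
    have h1 : (fun ω => ⟪a, Y ω⟫) = fun ω => ⟪Y.adjoint a, ω⟫ := by
      ext ω; rw [ContinuousLinearMap.adjoint_inner_left]
    have h2 : (fun ω => ⟪c, ⟪v, ω⟫⟫) = fun ω => ⟪c • v, ω⟫ := by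
      ext ω; simp [real_inner_smul_left, mul_comm]
    rw [h1, h2, covariance_inner_stdGaussian, ContinuousLinearMap.adjoint_inner_left]
    simp [hY]
  have hzero : ∫ ω, f (Y ω) * ⟪v, ω⟫ ∂γ = 0 := by
    have h := (hind.comp hf measurable_id).integral_fun_mul_eq_mul_integral
      hfY.aestronglyMeasurable hs.aestronglyMeasurable
    simp only [Function.comp_apply, id_eq] at h
    rw [h, integral_inner_stdGaussian, mul_zero]
  have hcross : ∫ ω, (f (Y ω) - ⟪x₀, ω⟫) * ⟪v, ω⟫ ∂γ = -⟪x₀, v⟫ := by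
    simp_rw [sub_mul]
    have h1 : Integrable (fun ω => f (Y ω) * ⟪v, ω⟫) γ := hfL.integrable_mul hs
    have h2 : Integrable (fun ω => ⟪x₀, ω⟫ * ⟪v, ω⟫) γ := hx.integrable_mul hs
    rw [integral_sub h1 h2, hzero, integral_inner_mul_inner_stdGaussian, zero_sub]
  have hvv : ∫ ω, ⟪v, ω⟫ * ⟪v, ω⟫ ∂γ = ‖v‖ ^ 2 := by
    rw [integral_inner_mul_inner_stdGaussian, real_inner_self_eq_norm_sq]
  rw [← ofReal_integral_eq_lintegral_ofReal herr_sq (.of_forall fun ω => sq_nonneg _)]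
  refine ENNReal.ofReal_le_ofReal ?_
  have hv2 : 0 < ‖v‖ ^ 2 := by positivity
  -- the minimiser over `c` of `E (error + c ⟪v, ω⟫)²`
  set c := ⟪x₀, v⟫ / ‖v‖ ^ 2 with hc
  have hnn : 0 ≤ ∫ ω, ((f (Y ω) - ⟪x₀, ω⟫) + c * ⟪v, ω⟫) ^ 2 ∂γ :=
    integral_nonneg fun ω => sq_nonneg _
  have hexp : ∀ ω, ((f (Y ω) - ⟪x₀, ω⟫) + c * ⟪v, ω⟫) ^ 2 = (f (Y ω) - ⟪x₀, ω⟫) ^ 2 +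
      (2 * c * ((f (Y ω) - ⟪x₀, ω⟫) * ⟪v, ω⟫) + c ^ 2 * (⟪v, ω⟫ * ⟪v, ω⟫)) := fun ω => by ring
  have hi1 : Integrable (fun ω => 2 * c * ((f (Y ω) - ⟪x₀, ω⟫) * ⟪v, ω⟫)) γ :=
    (herr.integrable_mul hs).const_mul (2 * c)
  have hi2 : Integrable (fun ω => c ^ 2 * (⟪v, ω⟫ * ⟪v, ω⟫)) γ :=
    (hs.integrable_mul hs).const_mul (c ^ 2)
  have hi12 : Integrable (fun ω => 2 * c * ((f (Y ω) - ⟪x₀, ω⟫) * ⟪v, ω⟫) +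
      c ^ 2 * (⟪v, ω⟫ * ⟪v, ω⟫)) γ := hi1.add hi2
  simp_rw [hexp] at hnn
  rw [integral_add herr_sq hi12, integral_add hi1 hi2, integral_const_mul,
    integral_const_mul, hcross, hvv] at hnn
  have : 2 * c * -⟪x₀, v⟫ + c ^ 2 * ‖v‖ ^ 2 = -(⟪x₀, v⟫ ^ 2 / ‖v‖ ^ 2) := by
    rw [hc]; field_simp; ring
  linarith

lemma measurePreserving_ofLp_stdGaussian {F : Type*} [NormedAddCommGroup F]
    [InnerProductSpace ℝ F] [FiniteDimensional ℝ F] [MeasurableSpace F] [BorelSpace F] :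
    MeasurePreserving (WithLp.ofLp : WithLp 2 (V × F) → V × F)
      (stdGaussian (WithLp 2 (V × F))) ((stdGaussian V).prod (stdGaussian F)) := by
  have h : stdGaussian (WithLp 2 (V × F)) =
      ((stdGaussian V).prod (stdGaussian F)).map (WithLp.toLp 2) := by
    have : IsProbabilityMeasure (((stdGaussian V).prod (stdGaussian F)).map (WithLp.toLp 2)) :=
      Measure.isProbabilityMeasure_map (WithLp.measurable_toLp 2 _).aemeasurable
    refine Measure.ext_of_charFun (funext fun t => ?_)
    rw [charFun_prod, charFun_stdGaussian, charFun_stdGaussian, charFun_stdGaussian,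
      ← Complex.exp_add, ← Complex.ofReal_pow, WithLp.prod_norm_sq_eq_of_L2]
    push_cast
    congr 1
    rw [WithLp.fst, WithLp.snd]
    ring
  refine ⟨WithLp.measurable_ofLp 2 _, ?_⟩
  rw [h, Measure.map_map (WithLp.measurable_ofLp 2 _) (WithLp.measurable_toLp 2 _)]
  exact Measure.map_id

end Gaussian

/-! ### The model in terms of standard Gaussian noise -/

lemma noiseLaw_eq_map_stdGaussian (m : ℕ) (σ : ℝ) :
    noiseLaw m σ = (stdGaussian (EuclideanSpace ℝ (Fin m))).map fun z => σ • z := by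
  have hm : Measurable fun z : EuclideanSpace ℝ (Fin m) => σ • z := measurable_const_smul σ
  have : IsProbabilityMeasure ((stdGaussian (EuclideanSpace ℝ (Fin m))).map fun z => σ • z) :=
    Measure.isProbabilityMeasure_map hm.aemeasurable
  have hpos : (σ ^ 2 • (1 : Matrix (Fin m) (Fin m) ℝ)).PosSemidef :=
    Matrix.PosSemidef.one.smul (sq_nonneg σ)
  unfold noiseLaw
  refine Measure.ext_of_charFun (funext fun t => ?_)
  rw [charFun_multivariateGaussian hpos, charFun_map_smul, charFun_stdGaussian, norm_smul]
  have hdot : t.ofLp ⬝ᵥ t.ofLp = ‖t‖ ^ 2 := by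
    rw [EuclideanSpace.real_norm_sq_eq]; simp [dotProduct, sq]
  simp only [Matrix.smul_mulVec, Matrix.one_mulVec, dotProduct_smul, hdot, inner_zero_right]
  congr 1
  push_cast [mul_pow]
  rw [← Complex.ofReal_pow ‖σ‖, Real.norm_eq_abs, sq_abs]
  simp [neg_div]

lemma meanSquaredError_eq {m n : ℕ} (A : Matrix (Fin m) (Fin n) ℝ) (σ : ℝ)
    {xhat : EuclideanSpace ℝ (Fin m) → EuclideanSpace ℝ (Fin n)} (hx : Measurable xhat)
    (x : EuclideanSpace ℝ (Fin n)) :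
    meanSquaredError A σ xhat x = ∫⁻ z, ENNReal.ofReal
      ((1 / (n : ℝ)) * ‖xhat (A.toEuclideanLin x + σ • z) - x‖ ^ 2)
        ∂stdGaussian (EuclideanSpace ℝ (Fin m)) := by
  unfold meanSquaredError observationLaw
  rw [noiseLaw_eq_map_stdGaussian, Measure.map_map (by fun_prop) (by fun_prop),
    lintegral_map (by fun_prop) (by fun_prop)]
  rfl

lemma natCast_mul_meanSquaredError {m n : ℕ} (hn : 1 ≤ n) (A : Matrix (Fin m) (Fin n) ℝ) (σ : ℝ)
    {xhat : EuclideanSpace ℝ (Fin m) → EuclideanSpace ℝ (Fin n)} (hx : Measurable xhat)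
    (x : EuclideanSpace ℝ (Fin n)) :
    n * meanSquaredError A σ xhat x = ∫⁻ z, ENNReal.ofReal
      (‖xhat (A.toEuclideanLin x + σ • z) - x‖ ^ 2)
        ∂stdGaussian (EuclideanSpace ℝ (Fin m)) := by
  rw [meanSquaredError_eq A σ hx, ← lintegral_const_mul _ (by fun_prop)]
  refine lintegral_congr fun z => ?_
  rw [← ENNReal.ofReal_natCast, ← ENNReal.ofReal_mul (by positivity)]
  congr 1
  have : (n : ℝ) ≠ 0 := by positivity
  field_simp

/-! ### Gaussian priors on the sparse vectors -/

section Columns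

variable {m n : ℕ}

/-- The `j`-th column of `A`, as a Euclidean vector. -/
noncomputable def columnVector (A : Matrix (Fin m) (Fin n) ℝ) (j : Fin n) :
    EuclideanSpace ℝ (Fin m) :=
  A.toEuclideanLin (EuclideanSpace.single j 1)

lemma sum_norm_columnVector_sq (A : Matrix (Fin m) (Fin n) ℝ) :
    ∑ j, ‖columnVector A j‖ ^ 2 = frobeniusNorm A ^ 2 := by
  have h : frobeniusNorm A ^ 2 = ∑ i, ∑ j, A i j ^ 2 := by
    unfold frobeniusNorm
    rw [Matrix.frobenius_norm_def, ← Real.sqrt_eq_rpow, Real.sq_sqrt (by positivity)]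
    simp
  rw [h, Finset.sum_comm]
  refine Finset.sum_congr rfl fun j _ => ?_
  rw [EuclideanSpace.real_norm_sq_eq]
  simp [columnVector, Matrix.toLpLin_apply]

/-- The coordinate projection of `ℝⁿ` that keeps the coordinates in `T`. -/
noncomputable def coordinateProjection (T : Finset (Fin n)) :
    EuclideanSpace ℝ (Fin n) →L[ℝ] EuclideanSpace ℝ (Fin n) :=
  ∑ j ∈ T, (EuclideanSpace.proj j : EuclideanSpace ℝ (Fin n) →L[ℝ] ℝ).smulRight
    (EuclideanSpace.single j 1)

lemma coordinateProjection_apply (T : Finset (Fin n)) (x : EuclideanSpace ℝ (Fin n)) (i : Fin n) :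
    coordinateProjection T x i = if i ∈ T then x i else 0 := by
  simp [coordinateProjection, Pi.single_apply]

lemma coordinateProjection_single {T : Finset (Fin n)} {j : Fin n} (hj : j ∈ T) (c : ℝ) :
    coordinateProjection T (EuclideanSpace.single j c) = EuclideanSpace.single j c := by
  ext i
  rw [coordinateProjection_apply]
  by_cases h : i = j
  · simp [h, hj]
  · simp [h]

lemma sum_sq_le_norm_sq (T : Finset (Fin n)) (x : EuclideanSpace ℝ (Fin n)) :
    ∑ j ∈ T, x j ^ 2 ≤ ‖x‖ ^ 2 := by
  rw [EuclideanSpace.real_norm_sq_eq]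
  exact Finset.sum_le_sum_of_subset_of_nonneg (Finset.subset_univ T) fun _ _ _ => sq_nonneg _

/-- The Bayes risk of estimating `x = τ g`, with `g` standard Gaussian on the coordinates in `T`,
is at least the sum over `T` of the inverses of the Fisher informations of the coordinates, the
prior contributing `1 / τ²` to each of them. -/
lemma sum_inv_information_le_risk {k : ℕ} (hn : 1 ≤ n) {σ τ : ℝ} (hσ : 0 < σ) (hτ : 0 < τ)
    (A : Matrix (Fin m) (Fin n) ℝ) {T : Finset (Fin n)} (hT : T.card ≤ k)
    {xhat : EuclideanSpace ℝ (Fin m) → EuclideanSpace ℝ (Fin n)} (hx : Measurable xhat) :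
    ∑ j ∈ T, ENNReal.ofReal (1 / (1 / τ ^ 2 + ‖columnVector A j‖ ^ 2 / σ ^ 2)) ≤
      n * ⨆ x ∈ sparseVectors n k, meanSquaredError A σ xhat x := by
  set P := coordinateProjection T with hP
  let B : EuclideanSpace ℝ (Fin n) →L[ℝ] EuclideanSpace ℝ (Fin m) :=
    A.toEuclideanLin.toContinuousLinearMap
  have hB : ∀ x, B x = A.toEuclideanLin x := fun x => rfl
  let Y : WithLp 2 (EuclideanSpace ℝ (Fin n) × EuclideanSpace ℝ (Fin m)) →L[ℝ]
      EuclideanSpace ℝ (Fin m) :=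
    B.comp ((τ • P).comp (WithLp.fstL 2 ℝ _ _)) + σ • WithLp.sndL 2 ℝ _ _
  have hYapp : ∀ ω, Y ω = B (τ • P ω.ofLp.1) + σ • ω.ofLp.2 := fun ω => rfl
  have hsparse : ∀ g, τ • P g ∈ sparseVectors n k := by
    intro g
    refine le_trans ?_ hT
    rw [← Set.ncard_coe_finset]
    refine Set.ncard_le_ncard (fun i hi => ?_) T.finite_toSet
    by_contra h
    exact hi (by simp [hP, coordinateProjection_apply, show i ∉ T from h])
  have hcoord : ∀ j ∈ T, ENNReal.ofReal (1 / (1 / τ ^ 2 + ‖columnVector A j‖ ^ 2 / σ ^ 2)) ≤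
      ∫⁻ p : EuclideanSpace ℝ (Fin n) × EuclideanSpace ℝ (Fin m),
        ENNReal.ofReal ((xhat (B (τ • P p.1) + σ • p.2) j - τ * p.1 j) ^ 2)
          ∂((stdGaussian _).prod (stdGaussian _)) := by
    intro j hj
    -- `⟪v, (g, w)⟫` is the score `⟪a_j, w⟫ / σ - g_j / τ` of the `j`-th coordinate
    set v : WithLp 2 (EuclideanSpace ℝ (Fin n) × EuclideanSpace ℝ (Fin m)) :=
      WithLp.toLp 2 (EuclideanSpace.single j (-τ⁻¹), σ⁻¹ • columnVector A j) with hv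
    set x₀ : WithLp 2 (EuclideanSpace ℝ (Fin n) × EuclideanSpace ℝ (Fin m)) :=
      WithLp.toLp 2 (EuclideanSpace.single j τ, 0) with hx₀
    have hYv : Y v = 0 := by
      have hs : τ • (EuclideanSpace.single j (-τ⁻¹) : EuclideanSpace ℝ (Fin n)) =
          -EuclideanSpace.single j 1 := by
        ext i
        by_cases h : i = j
        · subst h; simp [hτ.ne']
        · simp [h]
      rw [hYapp, hv]
      simp only
      rw [hP, coordinateProjection_single hj, hs, map_neg, hB, smul_inv_smul₀ hσ.ne',
        columnVector, neg_add_cancel]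
    have hinner : ⟪x₀, v⟫ = -1 := by
      rw [WithLp.prod_inner_apply]
      simp [hv, hx₀, EuclideanSpace.inner_single_left, hτ.ne']
    have hnorm : ‖v‖ ^ 2 = 1 / τ ^ 2 + ‖columnVector A j‖ ^ 2 / σ ^ 2 := by
      rw [WithLp.prod_norm_sq_eq_of_L2]
      simp [hv, norm_smul, mul_pow]
      ring
    have hv0 : v ≠ 0 := by
      rintro h
      rw [h, inner_zero_right] at hinner
      norm_num at hinner
    have h := le_lintegral_sq_sub_of_apply_eq_zero Y x₀ v hv0 hYv
      (f := fun y => xhat y j) (by fun_prop)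
    rw [hinner, hnorm, neg_one_sq] at h
    refine h.trans_eq ?_
    rw [← measurePreserving_ofLp_stdGaussian.lintegral_comp (by fun_prop)]
    refine lintegral_congr fun ω => ?_
    rw [WithLp.prod_inner_apply]
    simp [hx₀, hYapp, EuclideanSpace.inner_single_left]
  calc _ ≤ ∑ j ∈ T, ∫⁻ p : EuclideanSpace ℝ (Fin n) × EuclideanSpace ℝ (Fin m),
        ENNReal.ofReal ((xhat (B (τ • P p.1) + σ • p.2) j - τ * p.1 j) ^ 2)
          ∂((stdGaussian _).prod (stdGaussian _)) := Finset.sum_le_sum hcoord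
    _ = ∫⁻ p : EuclideanSpace ℝ (Fin n) × EuclideanSpace ℝ (Fin m),
        ∑ j ∈ T, ENNReal.ofReal ((xhat (B (τ • P p.1) + σ • p.2) j - τ * p.1 j) ^ 2)
          ∂((stdGaussian _).prod (stdGaussian _)) :=
        (lintegral_finsetSum _ fun j _ => by fun_prop).symm
    _ ≤ ∫⁻ p : EuclideanSpace ℝ (Fin n) × EuclideanSpace ℝ (Fin m),
        ENNReal.ofReal (‖xhat (B (τ • P p.1) + σ • p.2) - τ • P p.1‖ ^ 2)
          ∂((stdGaussian _).prod (stdGaussian _)) := by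
        refine lintegral_mono fun p => ?_
        rw [← ENNReal.ofReal_sum_of_nonneg fun j _ => sq_nonneg _]
        refine ENNReal.ofReal_le_ofReal (le_trans (le_of_eq ?_) (sum_sq_le_norm_sq T _))
        refine Finset.sum_congr rfl fun j hj => ?_
        simp [hP, coordinateProjection_apply, hj]
    _ = ∫⁻ g, ∫⁻ w, ENNReal.ofReal (‖xhat (B (τ • P g) + σ • w) - τ • P g‖ ^ 2)
          ∂stdGaussian (EuclideanSpace ℝ (Fin m)) ∂stdGaussian (EuclideanSpace ℝ (Fin n)) :=
        lintegral_prod _ (by fun_prop)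
    _ ≤ ∫⁻ g, n * (⨆ x ∈ sparseVectors n k, meanSquaredError A σ xhat x)
          ∂stdGaussian (EuclideanSpace ℝ (Fin n)) := by
        refine lintegral_mono fun g => ?_
        refine (natCast_mul_meanSquaredError hn A σ hx (τ • P g)).ge.trans ?_
        gcongr
        exact le_iSup₂_of_le (τ • P g) (hsparse g) le_rfl
    _ = _ := by simp

end Columns

/-- Some `k` of the values of `f` have at most the average of all of them. -/
lemma exists_card_eq_sum_le_average {ι : Type*} (s : Finset ι) (f : ι → ℝ) {k : ℕ}
    (hk : k ≤ s.card) :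
    ∃ T ⊆ s, T.card = k ∧ (s.card : ℝ) * ∑ j ∈ T, f j ≤ k * ∑ j ∈ s, f j := by
  classical
  induction s using Finset.strongInduction with
  | H s ih =>
    rcases hk.eq_or_lt with rfl | hlt
    · exact ⟨s, subset_rfl, rfl, le_rfl⟩
    have hne : s.Nonempty := Finset.card_pos.1 (by omega)
    obtain ⟨a, ha, hmax⟩ := s.exists_max_image f hne
    have hcard := Finset.card_erase_add_one ha
    obtain ⟨T, hTs, hTk, hT⟩ := ih (s.erase a) (Finset.erase_ssubset ha) (by omega)
    refine ⟨T, hTs.trans (Finset.erase_subset _ _), hTk, ?_⟩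
    have hsum := Finset.add_sum_erase s f ha
    have hTle : ∑ j ∈ T, f j ≤ k * f a := by
      rw [← hTk, ← nsmul_eq_mul]
      exact Finset.sum_le_card_nsmul _ _ _ fun j hj => hmax j (Finset.mem_of_mem_erase (hTs hj))
    have hc : (s.card : ℝ) = (s.erase a).card + 1 := by exact_mod_cast hcard.symm
    rw [hc, ← hsum]
    linarith

/-- The lower bound with `‖A‖_F² + ε` in the denominator; `ε` comes from the variance of the
prior. -/
lemma le_risk_of_pos {m n k : ℕ} (hk : 1 ≤ k) (hkn : k ≤ n) {σ ε : ℝ} (hσ : 0 < σ) (hε : 0 < ε)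
    (A : Matrix (Fin m) (Fin n) ℝ) {xhat : EuclideanSpace ℝ (Fin m) → EuclideanSpace ℝ (Fin n)}
    (hx : Measurable xhat) :
    ENNReal.ofReal (k * σ ^ 2 / (frobeniusNorm A ^ 2 + ε)) ≤
      ⨆ x ∈ sparseVectors n k, meanSquaredError A σ xhat x := by
  have hn : 0 < n := by omega
  have hnR : (0 : ℝ) < n := by exact_mod_cast hn
  have hkR : (0 : ℝ) < k := by exact_mod_cast hk
  obtain ⟨T, -, hTk, hT⟩ := exists_card_eq_sum_le_average Finset.univ
    (fun j => ‖columnVector A j‖ ^ 2) (by simpa using hkn : k ≤ (Finset.univ : Finset (Fin n)).card)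
  rw [sum_norm_columnVector_sq, Finset.card_univ, Fintype.card_fin] at hT
  have hτ : 0 < √(n * σ ^ 2 / ε) := Real.sqrt_pos.2 (by positivity)
  have h := sum_inv_information_le_risk (k := k) hn hσ hτ A hTk.le hx
  rw [Real.sq_sqrt (by positivity), ← ENNReal.ofReal_sum_of_nonneg fun j _ => by positivity] at h
  have hsed := Finset.sq_sum_div_le_sum_sq_div T (fun _ => (1 : ℝ))
    (g := fun j => 1 / (n * σ ^ 2 / ε) + ‖columnVector A j‖ ^ 2 / σ ^ 2) fun j _ => by positivity
  simp only [one_pow, Finset.sum_const, nsmul_eq_mul, mul_one, hTk, Finset.sum_add_distrib,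
    ← Finset.sum_div] at hsed
  have hnS : (n : ℝ) * (k * σ ^ 2 / (frobeniusNorm A ^ 2 + ε)) ≤
      ∑ j ∈ T, 1 / (1 / (n * σ ^ 2 / ε) + ‖columnVector A j‖ ^ 2 / σ ^ 2) := by
    refine le_trans ?_ hsed
    have hden : k * (1 / (n * σ ^ 2 / ε)) + (∑ j ∈ T, ‖columnVector A j‖ ^ 2) / σ ^ 2 ≤
        k * (frobeniusNorm A ^ 2 + ε) / (n * σ ^ 2) := by
      have : (∑ j ∈ T, ‖columnVector A j‖ ^ 2) / σ ^ 2 ≤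
          k * frobeniusNorm A ^ 2 / (n * σ ^ 2) := by
        rw [div_le_div_iff₀ (by positivity) (by positivity)]
        nlinarith [sq_nonneg σ]
      calc _ ≤ k * (1 / (n * σ ^ 2 / ε)) + k * frobeniusNorm A ^ 2 / (n * σ ^ 2) := by gcongr
        _ = _ := by field_simp; ring
    have hpos : 0 < k * (1 / (n * σ ^ 2 / ε)) + (∑ j ∈ T, ‖columnVector A j‖ ^ 2) / σ ^ 2 := by
      positivity
    calc _ = (k : ℝ) ^ 2 / (k * (frobeniusNorm A ^ 2 + ε) / (n * σ ^ 2)) := by field_simp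
      _ ≤ _ := by gcongr
  have hmain := (ENNReal.ofReal_le_ofReal hnS).trans h
  rw [ENNReal.ofReal_mul hnR.le, ENNReal.ofReal_natCast] at hmain
  exact (ENNReal.mul_le_mul_iff_right (by exact_mod_cast hn.ne') (ENNReal.natCast_ne_top n)).1 hmain

theorem div_frobeniusNorm_sq_le_sparseMinimaxRisk {m n k : ℕ} (hk : 1 ≤ k) (hkn : k ≤ n) {σ : ℝ}
    (hσ : 0 ≤ σ) (A : Matrix (Fin m) (Fin n) ℝ) :
    ENNReal.ofReal (k * σ ^ 2) / ENNReal.ofReal (frobeniusNorm A ^ 2) ≤ sparseMinimaxRisk k σ A := by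
  rcases hσ.eq_or_lt with rfl | hσ
  · simp
  refine le_iInf₂ fun xhat hx => ?_
  have hlim : Filter.Tendsto (fun ε : ℝ => ENNReal.ofReal (k * σ ^ 2) /
      ENNReal.ofReal (frobeniusNorm A ^ 2 + ε)) (nhdsWithin 0 (Set.Ioi 0))
      (nhds (ENNReal.ofReal (k * σ ^ 2) / ENNReal.ofReal (frobeniusNorm A ^ 2))) := by
    refine ENNReal.Tendsto.const_div (ENNReal.tendsto_ofReal ?_) (.inr ENNReal.ofReal_ne_top)
    have : Continuous fun ε : ℝ => frobeniusNorm A ^ 2 + ε := by fun_prop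
    simpa using (this.tendsto 0).mono_left nhdsWithin_le_nhds
  refine le_of_tendsto hlim ?_
  filter_upwards [self_mem_nhdsWithin] with ε hε
  have hε : 0 < ε := hε
  rw [← ENNReal.ofReal_div_of_pos (by positivity)]
  exact le_risk_of_pos hk hkn hσ hε A hx

/-! ### Spikes hidden in Gaussian noise -/

section Spike

variable {V : Type*} [NormedAddCommGroup V] [InnerProductSpace ℝ V] [FiniteDimensional ℝ V]
  [MeasurableSpace V] [BorelSpace V]

/-- Among `b ≥ 16` translates of the standard Gaussian law by vectors of squared norm at most
`log b / 2`, disjoint decision regions are hit with average probability at most `1 / 2`. -/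
lemma sum_stdGaussian_real_translate_le {b : ℕ} (hb : 16 ≤ b) (u : Fin b → V)
    (hu : ∀ j, ‖u j‖ ^ 2 ≤ Real.log b / 2) (D : Fin b → Set V) (hD : ∀ j, MeasurableSet (D j))
    (hdisj : Pairwise (Function.onFun Disjoint D)) :
    ∑ j, (stdGaussian V).real ((fun z => z + u j) ⁻¹' D j) ≤ b / 2 := by
  have hbR : (16 : ℝ) ≤ b := by exact_mod_cast hb
  have hb0 : (0 : ℝ) < b := by linarith
  have hs : 0 < √(b : ℝ) := Real.sqrt_pos.2 hb0
  have hss : √(b : ℝ) * √b = b := Real.mul_self_sqrt hb0.le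
  set K := Real.exp (Real.log b / 4)
  have hK : 0 < K := Real.exp_pos _
  have hK4 : K ^ 4 = b := by
    rw [← Real.exp_nat_mul]
    conv_rhs => rw [← Real.exp_log hb0]
    congr 1
    push_cast
    ring
  have hsum : ∑ j, (stdGaussian V).real (D j) ≤ 1 := by
    have := measureReal_biUnion_finset (μ := stdGaussian V) (s := Finset.univ) (f := D)
      (fun i _ j _ h => hdisj h) fun j _ => hD j
    rw [← this]
    exact measureReal_le_one
  -- balancing the two terms of `stdGaussian_real_translate_le` over the `b` regions gives `t = √b`
  calc ∑ j, (stdGaussian V).real ((fun z => z + u j) ⁻¹' D j)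
      ≤ ∑ j, K / 2 * (√b * (stdGaussian V).real (D j) + (√b)⁻¹) := by
        refine Finset.sum_le_sum fun j _ => ?_
        refine (stdGaussian_real_translate_le (u j) (hD j) hs).trans ?_
        gcongr
        exact Real.exp_le_exp.2 (by linarith [hu j])
    _ = K / 2 * (√b * ∑ j, (stdGaussian V).real (D j) + b * (√b)⁻¹) := by
        rw [← Finset.mul_sum, Finset.sum_add_distrib, ← Finset.mul_sum]
        simp
    _ ≤ K / 2 * (√b * 1 + b * (√b)⁻¹) := by gcongr
    _ = K * √b := by
        have : (b : ℝ) * (√b)⁻¹ = √b := by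
          rw [← div_eq_mul_inv, div_eq_iff hs.ne', hss]
        rw [this]; ring
    _ ≤ b / 2 := by
        have hK2 : 2 ≤ K := by
          by_contra h
          have : K ^ 4 < 2 ^ 4 := pow_lt_pow_left₀ (not_le.1 h) hK.le (by norm_num)
          linarith
        have hsK : √(b : ℝ) = K ^ 2 := by
          rw [← hK4, show K ^ 4 = (K ^ 2) ^ 2 by ring, Real.sqrt_sq (by positivity)]
        rw [hsK, ← hK4]
        nlinarith [pow_pos hK 3]

lemma norm_single_sub_single_sq {b : ℕ} {i j : Fin b} (h : i ≠ j) (μ : ℝ) :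
    ‖(EuclideanSpace.single i μ : EuclideanSpace ℝ (Fin b)) - EuclideanSpace.single j μ‖ ^ 2 =
      2 * μ ^ 2 := by
  rw [norm_sub_sq_real, EuclideanSpace.inner_single_left]
  simp [h]
  ring

/-- The average risk of locating a spike of height `μ` at one of `b` places. -/
lemma le_sum_lintegral_spike {b : ℕ} (hb : 16 ≤ b) {σ : ℝ} (hσ : 0 < σ) (μ : ℝ) (w : V)
    (u : Fin b → V) (hu : ∀ j, ‖u j‖ ^ 2 ≤ σ ^ 2 * (Real.log b / 2))
    {vhat : V → EuclideanSpace ℝ (Fin b)} (hv : Measurable vhat) :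
    ENNReal.ofReal (b * (μ ^ 2 / 4)) ≤ ∑ j, ∫⁻ z, ENNReal.ofReal
      (‖vhat (w + u j + σ • z) - EuclideanSpace.single j μ‖ ^ 2) ∂stdGaussian V := by
  let D : Fin b → Set V := fun j =>
    {z | ‖vhat (w + σ • z) - EuclideanSpace.single j μ‖ ^ 2 < μ ^ 2 / 2}
  have hDm : ∀ j, MeasurableSet (D j) := fun j =>
    measurableSet_lt (by fun_prop) measurable_const
  have hdisj : Pairwise (Function.onFun Disjoint D) := by
    intro i j hij
    refine Set.disjoint_left.2 fun z hi hj => ?_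
    have h := norm_single_sub_single_sq hij μ
    have hi : ‖vhat (w + σ • z) - EuclideanSpace.single i μ‖ ^ 2 < μ ^ 2 / 2 := hi
    have hj : ‖vhat (w + σ • z) - EuclideanSpace.single j μ‖ ^ 2 < μ ^ 2 / 2 := hj
    have hpar := parallelogram_law_with_norm ℝ (vhat (w + σ • z) - EuclideanSpace.single j μ)
      (vhat (w + σ • z) - EuclideanSpace.single i μ)
    rw [sub_sub_sub_cancel_left] at hpar
    nlinarith [norm_nonneg (vhat (w + σ • z) - EuclideanSpace.single j μ +
      (vhat (w + σ • z) - EuclideanSpace.single i μ))]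
  have hhit := sum_stdGaussian_real_translate_le hb (fun j => σ⁻¹ • u j) (fun j => by
    rw [norm_smul, mul_pow, norm_inv, Real.norm_of_nonneg hσ.le, inv_pow,
      inv_mul_le_iff₀ (by positivity)]
    exact hu j) D hDm hdisj
  set H : Fin b → Set V := fun j => (fun z => z + σ⁻¹ • u j) ⁻¹' D j with hH
  have hHm : ∀ j, MeasurableSet (H j) := fun j => measurable_add_const _ (hDm j)
  have hmiss : ∀ j, ENNReal.ofReal (μ ^ 2 / 2 * (1 - (stdGaussian V).real (H j))) ≤
      ∫⁻ z, ENNReal.ofReal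
        (‖vhat (w + u j + σ • z) - EuclideanSpace.single j μ‖ ^ 2) ∂stdGaussian V := by
    intro j
    rw [← probReal_compl_eq_one_sub (hHm j), ENNReal.ofReal_mul (by positivity),
      ofReal_measureReal, ← setLIntegral_const]
    refine (setLIntegral_mono (by fun_prop) fun z hz => ?_).trans (setLIntegral_le_lintegral _ _)
    refine ENNReal.ofReal_le_ofReal (not_lt.1 fun h => hz ?_)
    have : w + σ • (z + σ⁻¹ • u j) = w + u j + σ • z := by
      rw [smul_add, smul_inv_smul₀ hσ.ne']; abel
    rw [← this] at h
    exact h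
  refine le_trans ?_ (Finset.sum_le_sum fun j _ => hmiss j)
  rw [← ENNReal.ofReal_sum_of_nonneg fun j _ =>
    mul_nonneg (by positivity) (sub_nonneg.2 measureReal_le_one)]
  refine ENNReal.ofReal_le_ofReal ?_
  rw [← Finset.mul_sum, Finset.sum_sub_distrib]
  simp only [Finset.sum_const, Finset.card_univ, Fintype.card_fin, nsmul_eq_mul, mul_one]
  nlinarith [sq_nonneg μ]

end Spike

/-- Resampling one coordinate of a uniformly distributed function keeps it uniformly
distributed. -/
lemma sum_sum_update {α β M : Type*} [Fintype α] [DecidableEq α] [Fintype β] [AddCommMonoid M]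
    (a : α) (F : (α → β) → M) :
    ∑ J : α → β, ∑ j : β, F (Function.update J a j) = Fintype.card β • ∑ J, F J := by
  -- resampling and remembering the old value is an involution
  let e : (α → β) × β → (α → β) × β := fun p => (Function.update p.1 a p.2, p.1 a)
  have he : Function.Involutive e := fun p => by simp [e]
  calc _ = ∑ p : (α → β) × β, F (e p).1 := by rw [Fintype.sum_prod_type]
    _ = ∑ p : (α → β) × β, F p.1 := Equiv.sum_comp (he.toPerm e) fun p => F p.1
    _ = _ := by
      rw [Fintype.sum_prod_type_right]
      simp

/-! ### Block priors -/

section Blocks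

variable {m n k b : ℕ}

/-- The vector with entry `μ` at one place `J l` of each of `k` disjoint blocks of size `b`; the
block `l` consists of the coordinates `ι (l, i)`. -/
noncomputable def blockSpikes (ι : Fin k × Fin b → Fin n) (μ : ℝ) (J : Fin k → Fin b) :
    EuclideanSpace ℝ (Fin n) :=
  ∑ l, EuclideanSpace.single (ι (l, J l)) μ

lemma blockSpikes_apply {ι : Fin k × Fin b → Fin n} (hι : Function.Injective ι) (μ : ℝ)
    (J : Fin k → Fin b) (l : Fin k) (i : Fin b) :
    blockSpikes ι μ J (ι (l, i)) = EuclideanSpace.single (J l) μ i := by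
  unfold blockSpikes
  rw [WithLp.ofLp_sum, Finset.sum_apply, Finset.sum_eq_single l]
  · simp [hι.eq_iff]
  · intro l' _ h
    simp [hι.eq_iff, Ne.symm h]
  · simp

lemma blockSpikes_mem_sparseVectors (ι : Fin k × Fin b → Fin n) (μ : ℝ) (J : Fin k → Fin b) :
    blockSpikes ι μ J ∈ sparseVectors n k := by
  have hsub : {i | blockSpikes ι μ J i ≠ 0} ⊆
      (Finset.univ.image fun l => ι (l, J l) : Finset (Fin n)) := by
    intro i hi
    by_contra h
    refine hi ?_
    unfold blockSpikes
    rw [WithLp.ofLp_sum, Finset.sum_apply]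
    refine Finset.sum_eq_zero fun l _ => ?_
    have : i ≠ ι (l, J l) := by
      rintro rfl
      exact h (by simp)
    simp [this]
  refine (Set.ncard_le_ncard hsub (Finset.finite_toSet _)).trans ?_
  rw [Set.ncard_coe_finset]
  exact Finset.card_image_le.trans (by simp)

/-- The observation at `blockSpikes` splits into the contribution of a block and a part that does
not depend on the spike in that block. -/
lemma toEuclideanLin_blockSpikes_update (A : Matrix (Fin m) (Fin n) ℝ)
    (ι : Fin k × Fin b → Fin n) (μ : ℝ) (J : Fin k → Fin b) (l : Fin k) (j : Fin b) :
    A.toEuclideanLin (blockSpikes ι μ (Function.update J l j)) =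
      A.toEuclideanLin (∑ l' ∈ Finset.univ.erase l, EuclideanSpace.single (ι (l', J l')) μ) +
        μ • columnVector A (ι (l, j)) := by
  have hs : μ • columnVector A (ι (l, j)) =
      A.toEuclideanLin (EuclideanSpace.single (ι (l, j)) μ) := by
    rw [columnVector, ← map_smul]
    congr 1
    ext i
    simp
  rw [hs, ← map_add]
  unfold blockSpikes
  rw [← Finset.add_sum_erase _ _ (Finset.mem_univ l), add_comm]
  congr 2
  · refine Finset.sum_congr rfl fun l' hl' => ?_
    rw [Function.update_of_ne (Finset.ne_of_mem_erase hl')]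
  · simp

lemma sum_block_norm_sq_le {ι : Fin k × Fin b → Fin n} (hι : Function.Injective ι)
    (x : EuclideanSpace ℝ (Fin n)) :
    ∑ l, ∑ i, x (ι (l, i)) ^ 2 ≤ ‖x‖ ^ 2 := by
  rw [EuclideanSpace.real_norm_sq_eq, ← Fintype.sum_prod_type (f := fun p => x (ι p) ^ 2)]
  calc _ = ∑ i ∈ Finset.univ.map ⟨ι, hι⟩, x i ^ 2 := by rw [Finset.sum_map]; rfl
    _ ≤ _ := Finset.sum_le_sum_of_subset_of_nonneg (Finset.subset_univ _) fun _ _ _ => sq_nonneg _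

/-- Averaging the risk over independent uniform spike positions in `k` blocks. -/
lemma block_spikes_le_risk (hn : 1 ≤ n) (hb : 16 ≤ b) {σ : ℝ} (hσ : 0 < σ) (μ : ℝ)
    (A : Matrix (Fin m) (Fin n) ℝ) {ι : Fin k × Fin b → Fin n} (hι : Function.Injective ι)
    (hA : ∀ p, μ ^ 2 * ‖columnVector A (ι p)‖ ^ 2 ≤ σ ^ 2 * (Real.log b / 2))
    {xhat : EuclideanSpace ℝ (Fin m) → EuclideanSpace ℝ (Fin n)} (hx : Measurable xhat) :
    ENNReal.ofReal (k * (μ ^ 2 / 4)) ≤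
      n * ⨆ x ∈ sparseVectors n k, meanSquaredError A σ xhat x := by
  set S := ⨆ x ∈ sparseVectors n k, meanSquaredError A σ xhat x
  -- the part of the estimate in block `l`
  let vhat : Fin k → EuclideanSpace ℝ (Fin m) → EuclideanSpace ℝ (Fin b) :=
    fun l y => WithLp.toLp 2 fun i => xhat y (ι (l, i))
  have hvhat : ∀ l, Measurable (vhat l) := fun l => by
    refine (WithLp.measurable_toLp 2 _).comp (measurable_pi_lambda _ fun i => ?_)
    fun_prop
  let err : Fin k → (Fin k → Fin b) → ℝ≥0∞ := fun l J => ∫⁻ z, ENNReal.ofReal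
    (‖vhat l (A.toEuclideanLin (blockSpikes ι μ J) + σ • z) - EuclideanSpace.single (J l) μ‖ ^ 2)
      ∂stdGaussian (EuclideanSpace ℝ (Fin m))
  have herr : ∀ J, ∑ l, err l J ≤ n * S := by
    intro J
    calc ∑ l, err l J = ∫⁻ z, ∑ l, ENNReal.ofReal
          (‖vhat l (A.toEuclideanLin (blockSpikes ι μ J) + σ • z) -
            EuclideanSpace.single (J l) μ‖ ^ 2) ∂stdGaussian (EuclideanSpace ℝ (Fin m)) :=
          (lintegral_finsetSum _ fun l _ => by have := hvhat l; fun_prop).symm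
      _ ≤ ∫⁻ z, ENNReal.ofReal (‖xhat (A.toEuclideanLin (blockSpikes ι μ J) + σ • z) -
            blockSpikes ι μ J‖ ^ 2) ∂stdGaussian (EuclideanSpace ℝ (Fin m)) := by
          refine lintegral_mono fun z => ?_
          rw [← ENNReal.ofReal_sum_of_nonneg fun l _ => sq_nonneg _]
          refine ENNReal.ofReal_le_ofReal (le_trans (le_of_eq ?_) (sum_block_norm_sq_le hι _))
          refine Finset.sum_congr rfl fun l _ => ?_
          rw [EuclideanSpace.real_norm_sq_eq]
          refine Finset.sum_congr rfl fun i _ => ?_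
          rw [PiLp.sub_apply, PiLp.sub_apply, blockSpikes_apply hι]
      _ = n * meanSquaredError A σ xhat (blockSpikes ι μ J) :=
          (natCast_mul_meanSquaredError hn A σ hx _).symm
      _ ≤ n * S := by
          gcongr
          exact le_iSup₂_of_le _ (blockSpikes_mem_sparseVectors ι μ J) le_rfl
  set N : ℕ := Fintype.card (Fin k → Fin b) with hN
  have hblock : ∀ l, (N : ℝ≥0∞) * ENNReal.ofReal (b * (μ ^ 2 / 4)) ≤ b * ∑ J, err l J := by
    intro l
    have hupd := sum_sum_update l (err l)
    rw [Fintype.card_fin, nsmul_eq_mul] at hupd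
    rw [← hupd, hN, ← nsmul_eq_mul, ← Finset.card_univ]
    refine Finset.card_nsmul_le_sum _ _ _ fun J _ => ?_
    refine (le_sum_lintegral_spike hb hσ μ (A.toEuclideanLin
      (∑ l' ∈ Finset.univ.erase l, EuclideanSpace.single (ι (l', J l')) μ))
      (fun j => μ • columnVector A (ι (l, j)))
      (fun j => ?_) (hvhat l)).trans_eq (Finset.sum_congr rfl fun j _ => ?_)
    · rw [norm_smul, mul_pow, Real.norm_eq_abs, sq_abs]
      exact hA _
    · simp only [err, toEuclideanLin_blockSpikes_update, Function.update_self]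
  have hN0 : (N : ℝ≥0∞) ≠ 0 := by
    have : Nonempty (Fin k → Fin b) := ⟨fun _ => ⟨0, by omega⟩⟩
    exact_mod_cast Fintype.card_ne_zero
  have hb0 : (b : ℝ≥0∞) ≠ 0 := by exact_mod_cast (by omega : b ≠ 0)
  rw [← ENNReal.mul_le_mul_iff_right hN0 (ENNReal.natCast_ne_top N),
    ← ENNReal.mul_le_mul_iff_right hb0 (ENNReal.natCast_ne_top b)]
  calc (b : ℝ≥0∞) * (N * ENNReal.ofReal (k * (μ ^ 2 / 4)))
      = ∑ _l : Fin k, (N : ℝ≥0∞) * ENNReal.ofReal (b * (μ ^ 2 / 4)) := by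
        rw [Finset.sum_const, Finset.card_univ, Fintype.card_fin, nsmul_eq_mul,
          ENNReal.ofReal_mul (by positivity), ENNReal.ofReal_mul (by positivity),
          ENNReal.ofReal_natCast, ENNReal.ofReal_natCast]
        ring
    _ ≤ ∑ l, b * ∑ J, err l J := Finset.sum_le_sum fun l _ => hblock l
    _ = b * ∑ J, ∑ l, err l J := by rw [← Finset.mul_sum, Finset.sum_comm]
    _ ≤ b * ∑ _J : Fin k → Fin b, n * S := by
        gcongr with J _
        exact herr J
    _ = b * (N * (n * S)) := by
        rw [Finset.sum_const, Finset.card_univ, nsmul_eq_mul]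

/-- At least half of the columns have at most twice the average squared norm. -/
lemma card_small_columns (A : Matrix (Fin m) (Fin n) ℝ) (hA : 0 < frobeniusNorm A ^ 2) :
    n ≤ 2 * (Finset.univ.filter fun j =>
      n * ‖columnVector A j‖ ^ 2 ≤ 2 * frobeniusNorm A ^ 2).card := by
  set G := Finset.univ.filter fun j => n * ‖columnVector A j‖ ^ 2 ≤ 2 * frobeniusNorm A ^ 2
  have hcard : G.card + Gᶜ.card = n := by
    rw [Finset.card_add_card_compl, Fintype.card_fin]
  have hlarge : Gᶜ.card * (2 * frobeniusNorm A ^ 2) ≤ n * frobeniusNorm A ^ 2 := by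
    calc _ = Gᶜ.card • (2 * frobeniusNorm A ^ 2) := (nsmul_eq_mul _ _).symm
      _ ≤ ∑ j ∈ Gᶜ, n * ‖columnVector A j‖ ^ 2 :=
          Finset.card_nsmul_le_sum _ _ _ fun j hj => by
            have : ¬ n * ‖columnVector A j‖ ^ 2 ≤ 2 * frobeniusNorm A ^ 2 := by
              simpa [G] using hj
            exact (not_le.1 this).le
      _ ≤ ∑ j, n * ‖columnVector A j‖ ^ 2 :=
          Finset.sum_le_sum_of_subset_of_nonneg (Finset.subset_univ _)
            fun _ _ _ => by positivity
      _ = _ := by rw [← Finset.mul_sum, sum_norm_columnVector_sq]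
  have h2 : (Gᶜ.card : ℝ) * 2 ≤ n := by nlinarith
  have h2 : Gᶜ.card * 2 ≤ n := by exact_mod_cast h2
  omega

/-- The blocks are taken among the columns of small norm, so that one height `μ` serves for all
of them. -/
lemma log_le_risk_of_large_ratio (hk : 1 ≤ k) (hkn : 64 * k ≤ n) {σ : ℝ} (hσ : 0 < σ)
    (A : Matrix (Fin m) (Fin n) ℝ) (hA : 0 < frobeniusNorm A ^ 2)
    {xhat : EuclideanSpace ℝ (Fin m) → EuclideanSpace ℝ (Fin n)} (hx : Measurable xhat) :
    ENNReal.ofReal (1 / 64 * (k * σ ^ 2) * Real.log (n / k) / frobeniusNorm A ^ 2) ≤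
      ⨆ x ∈ sparseVectors n k, meanSquaredError A σ xhat x := by
  have hn : 0 < n := by omega
  have hnR : (0 : ℝ) < n := by exact_mod_cast hn
  have hkR : (0 : ℝ) < k := by exact_mod_cast hk
  set G := Finset.univ.filter fun j => n * ‖columnVector A j‖ ^ 2 ≤ 2 * frobeniusNorm A ^ 2 with hG
  have hGcard : n ≤ 2 * G.card := card_small_columns A hA
  set b := G.card / k with hb
  have hb16 : 16 ≤ b := by
    rw [hb, Nat.le_div_iff_mul_le (by omega)]
    omega
  have hkb : k * b ≤ G.card := Nat.mul_div_le _ _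
  have hnb : n ≤ 4 * k * b := by
    have : G.card < k * (b + 1) := by
      rw [hb]; exact Nat.lt_mul_div_succ _ (by omega)
    nlinarith
  obtain ⟨e⟩ : Nonempty (Fin k × Fin b ↪ G) :=
    Function.Embedding.nonempty_of_card_le (by simpa using hkb)
  have hbR : (16 : ℝ) ≤ b := by exact_mod_cast hb16
  have hlogb : 0 ≤ Real.log b := Real.log_nonneg (by linarith)
  -- the height at which a spike in a column with `n ‖a_j‖² = 2 ‖A‖_F²` is shifted by exactly the
  -- amount that `block_spikes_le_risk` tolerates
  set μ := √(n * σ ^ 2 * Real.log b / (4 * frobeniusNorm A ^ 2)) with hμ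
  have hμ2 : μ ^ 2 = n * σ ^ 2 * Real.log b / (4 * frobeniusNorm A ^ 2) :=
    Real.sq_sqrt (by positivity)
  have h := block_spikes_le_risk (k := k) (ι := fun p => (e p : Fin n)) hn hb16 hσ μ A
    (Subtype.val_injective.comp e.injective) (fun p => ?_) hx
  · have hlog : Real.log (n / k) ≤ 2 * Real.log b := by
      have h1 : (n : ℝ) / k ≤ b ^ 2 := by
        rw [div_le_iff₀ hkR]
        have : (n : ℝ) ≤ 4 * k * b := by exact_mod_cast hnb
        nlinarith [mul_pos hkR (by linarith : (0 : ℝ) < b)]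
      have h2 := Real.log_le_log (by positivity) h1
      rw [Real.log_pow] at h2
      simpa using h2
    have hle : (n : ℝ) * (1 / 64 * (k * σ ^ 2) * Real.log (n / k) / frobeniusNorm A ^ 2) ≤
        k * (μ ^ 2 / 4) := by
      rw [hμ2]
      calc _ = n * k * σ ^ 2 / (64 * frobeniusNorm A ^ 2) * Real.log (n / k) := by
            field_simp
        _ ≤ n * k * σ ^ 2 / (64 * frobeniusNorm A ^ 2) * (4 * Real.log b) := by
            gcongr; linarith
        _ = _ := by field_simp; ring
    have hmain := (ENNReal.ofReal_le_ofReal hle).trans h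
    rw [ENNReal.ofReal_mul hnR.le, ENNReal.ofReal_natCast] at hmain
    exact (ENNReal.mul_le_mul_iff_right (by exact_mod_cast hn.ne')
      (ENNReal.natCast_ne_top n)).1 hmain
  · have hp : n * ‖columnVector A (e p)‖ ^ 2 ≤ 2 * frobeniusNorm A ^ 2 :=
      (Finset.mem_filter.1 (e p).2).2
    rw [hμ2]
    calc _ = σ ^ 2 * Real.log b / (4 * frobeniusNorm A ^ 2) *
          (n * ‖columnVector A (e p)‖ ^ 2) := by ring
      _ ≤ σ ^ 2 * Real.log b / (4 * frobeniusNorm A ^ 2) * (2 * frobeniusNorm A ^ 2) := by gcongr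
      _ = _ := by
        have : frobeniusNorm A ≠ 0 := fun h => by simp [h] at hA
        field_simp
        norm_num

end Blocks

/-! ### The minimax lower bounds -/

theorem log_div_frobeniusNorm_sq_le_sparseMinimaxRisk {m n k : ℕ} (hk : 1 ≤ k) (hkn : k ≤ n)
    {σ : ℝ} (hσ : 0 ≤ σ) (A : Matrix (Fin m) (Fin n) ℝ) :
    ENNReal.ofReal (1 / 64 * (k * σ ^ 2) * Real.log (n / k)) /
      ENNReal.ofReal (frobeniusNorm A ^ 2) ≤ sparseMinimaxRisk k σ A := by
  have hkR : (0 : ℝ) < k := by exact_mod_cast hk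
  have hnR : (0 : ℝ) < n := by exact_mod_cast (by omega : 0 < n)
  have hmain := div_frobeniusNorm_sq_le_sparseMinimaxRisk hk hkn hσ A
  rcases hσ.eq_or_lt with rfl | hσ
  · simp
  rcases (sq_nonneg (frobeniusNorm A)).eq_or_lt with hA | hA
  · -- for `A = 0` the risk is already infinite
    have hnum : ENNReal.ofReal (k * σ ^ 2) ≠ 0 := by
      rw [ne_eq, ENNReal.ofReal_eq_zero, not_le]
      positivity
    rw [← hA, ENNReal.ofReal_zero, ENNReal.div_zero hnum, top_le_iff] at hmain
    rw [hmain]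
    exact le_top
  by_cases hlarge : 64 * k ≤ n
  · refine le_iInf₂ fun xhat hx => ?_
    rw [← ENNReal.ofReal_div_of_pos hA]
    exact log_le_risk_of_large_ratio hk hlarge hσ A hA hx
  · -- for `n / k < 64` the logarithm is bounded by a constant
    refine le_trans ?_ hmain
    refine ENNReal.div_le_div_right (ENNReal.ofReal_le_ofReal ?_) _
    have h64 : (n : ℝ) / k ≤ 64 := by
      rw [div_le_iff₀ hkR]
      exact_mod_cast (by omega : n ≤ 64 * k)
    have hlog := Real.log_le_sub_one_of_pos (div_pos hnR hkR)
    calc 1 / 64 * (k * σ ^ 2) * Real.log (n / k) ≤ 1 / 64 * (k * σ ^ 2) * 64 := by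
          gcongr; linarith
      _ = k * σ ^ 2 := by ring

theorem theorem1 :
    (∃ C₁ : ℝ, 0 < C₁ ∧
      ∀ (m n k : ℕ) (σ : ℝ) (A : Matrix (Fin m) (Fin n) ℝ),
        1 ≤ k → k ≤ n → k ≤ m → 0 ≤ σ →
        ENNReal.ofReal (C₁ * (k * σ ^ 2) * Real.log ((n : ℝ) / (k : ℝ)))
            / ENNReal.ofReal (frobeniusNorm A ^ 2)
          ≤ sparseMinimaxRisk k σ A) ∧
    (∀ (m n k : ℕ) (σ : ℝ) (A : Matrix (Fin m) (Fin n) ℝ),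
        1 ≤ k → k ≤ n → k ≤ m → 0 ≤ σ →
        ENNReal.ofReal (k * σ ^ 2) / ENNReal.ofReal (frobeniusNorm A ^ 2)
          ≤ sparseMinimaxRisk k σ A) :=
  ⟨⟨1 / 64, by norm_num, fun _ _ _ _ A hk hkn _ hσ =>
      log_div_frobeniusNorm_sq_le_sparseMinimaxRisk hk hkn hσ A⟩,
    fun _ _ _ _ A hk hkn _ hσ => div_frobeniusNorm_sq_le_sparseMinimaxRisk hk hkn hσ A⟩
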